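/- Let $A$ be a unital commutative real algebra. For a unital subalgebra $S\subseteq A$ (including $S=A$) let $X(S)$ be the set of all unital $\mathbb{R}$-algebra homomorphisms $S\to\mathbb{R}$, with the weakest topology making all evaluations $\hat a:\alpha\mapsto\alpha(a)$, $a\in S$, continuous, and with its Borel $\sigma$-algebra. For $S\subseteq T$ let $\pi_{S,T}:X(T)\to X(S)$ be the restriction map, and $\pi_S:=\pi_{S,A}$. Let $I$ (resp. $\Lambda$) be the set of all finitely (resp. countably) generated unital subalgebras of $A$, and let $\Sigma_I$ be the smallest $\sigma$-algebra on $X(A)$ making all $\pi_S:X(A)\to X(S)$, $S\in I$, measurable. A Radon measure is a locally finite Borel measure that is inner regular with respect to compact sets on all Borel sets. A $K$-representing measure for a linear functional $L$ on $S$ is a measure $\mu$ on the given $\sigma$-algebra of $X(S)$, to which $K$ belongs, with $\mu(X(S)\setminus K)=0$ and $L(a)=\int\hat a\,d\mu$ for all $a\in S$ (all $\hat a$ being integrable). A family $\{\mu_S:S\in J\}$ of Borel measures $\mu_S$ on $X(S)$, where $J$ is $I$ or $\Lambda$, is *exact* if $(\pi_{S,T})_\#\mu_T=\mu_S$ for all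 $S\subseteq T$ in $J$; it is *thick* if $\mu_S(M)=0$ for every $S\in J$ and every Borel set $M\subseteq X(S)$ with $M\cap\pi_S(X(A))=\emptyset$. For an exact family $\{\mu_S:S\in I\}$ of Radon probability measures, the corresponding exact family $\{\mu_T:T\in\Lambda\}$ consists of the (uniquely determined) Radon probability measures $\mu_T$ on $X(T)$ with $(\pi_{S,T})_\#\mu_T=\mu_S$ for all $S\in I$ with $S\subseteq T$. A family $\{\mu_S:S\in I\}$ satisfies *Prokhorov's condition* if for every $\varepsilon>0$ there is a compact $C_\varepsilon\subseteq X(A)$ with $\mu_S(\pi_S(C_\varepsilon))\ge 1-\varepsilon$ for all $S\in I$. A quadratic module in $A$ is a set $Q\subseteq A$ with $1\in Q$, $Q+Q\subseteq Q$ and $a^2Q\subseteq Q$ for all $a\in A$; it is countably generated if it is the smallest quadratic module containing some countable set. Put $K_Q:=\{\alpha\in X(A):\alpha(a)\ge0\ \forall a\in Q\}$ and, for $S\in I$, $K_{Q\cap S}:=\{\alpha\in X(S):\alpha(a)\ge0\ \forall a\in Q\cap S\}$. **Corollary.** Let $L:A\to\mathbb{R}$ be linear with $L(1)=1$ and let $K\subseteq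 X(A)$ be closed. Then $K=K_Q$ for some quadratic module $Q$ in $A$, and for every quadratic module $Q$ in $A$ with $K=K_Q$ the following hold. (i) There exists an $X(A)$-representing measure $\mu$ for $L$ on $\Sigma_I$ that is supported on $\pi_S^{-1}(K_{Q\cap S})$ for every $S\in I$ (i.e. its complement is $\mu$-null) if and only if for every $S\in I$ there exists a $K_{Q\cap S}$-representing Radon measure $\mu_S$ for $L\!\restriction_S$ such that $\{\mu_S:S\in I\}$ is exact and the corresponding exact family $\{\mu_T:T\in\Lambda\}$ is thick. Moreover, if $Q$ is countably generated, then every such $\mu$ is a $K$-representing measure for $L$ on $\Sigma_I$. (ii) There exists a $K$-representing Radon measure $\nu$ for $L$ on $X(A)$ if and only if for every $S\in I$ there exists a $K_{Q\cap S}$-representing Radon measure $\mu_S$ for $L\!\restriction_S$ such that $\{\mu_S:S\in I\}$ satisfies Prokhorov's condition. -/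

import Mathlib

open MeasureTheory Set Topology

noncomputable section

namespace CharMoment

/-- The character space `X(A)` of a unital commutative real algebra `A`: all unital `ℝ`-algebra
homomorphisms `A → ℝ` (no topology on `A`, hence no continuity). -/
abbrev CharSpace (A : Type*) [CommRing A] [Algebra ℝ A] : Type _ := A →ₐ[ℝ] ℝ

/-- The weakest topology making all evaluations `α ↦ α a` continuous. -/
instance instTopologicalSpaceCharSpace (A : Type*) [CommRing A] [Algebra ℝ A] :
    TopologicalSpace (CharSpace A) :=
  TopologicalSpace.induced (fun (α : CharSpace A) (a : A) => α a) inferInstance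

/-- By default `X(A)` carries its Borel σ-algebra. -/
instance instMeasurableSpaceCharSpace (A : Type*) [CommRing A] [Algebra ℝ A] :
    MeasurableSpace (CharSpace A) := borel _

instance instBorelSpaceCharSpace (A : Type*) [CommRing A] [Algebra ℝ A] :
    BorelSpace (CharSpace A) := ⟨rfl⟩

section Systems

variable {A : Type*} [CommRing A] [Algebra ℝ A]

/-- The restriction map `π_{S,T} : X(T) → X(S)` for subalgebras `S ⊆ T`. -/
def restr {S T : Subalgebra ℝ A} (h : S ≤ T) (α : CharSpace T) : CharSpace S :=
  α.comp (Subalgebra.inclusion h)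

/-- The restriction map `π_S : X(A) → X(S)`. -/
def proj (S : Subalgebra ℝ A) (α : CharSpace A) : CharSpace S := α.comp S.val

variable (A) in
/-- The index set `I` of all finitely generated (unital) subalgebras. -/
def fgSub : Set (Subalgebra ℝ A) := {S | S.FG}

variable (A) in
/-- The index set `Λ` of all countably generated (unital) subalgebras. -/
def cgSub : Set (Subalgebra ℝ A) :=
  {T | ∃ G : Set A, G.Countable ∧ Algebra.adjoin ℝ G = T}

variable (A) in
/-- The cylinder σ-algebra `Σ_I` on `X(A)`: the smallest one making every
`π_S : X(A) → (X(S), Borel)`, `S ∈ I`, measurable. -/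
@[reducible] def cylinderSigma : MeasurableSpace (CharSpace A) :=
  ⨆ S : fgSub A, MeasurableSpace.comap (proj S.1) (borel (CharSpace S.1))

/-- Radon measure on the Borel σ-algebra of `X(A)`: locally finite, and inner regular with respect
to compact sets on every Borel set. -/
structure IsRadon (μ : Measure (CharSpace A)) : Prop where
  locallyFinite : IsLocallyFiniteMeasure μ
  innerRegular : μ.InnerRegular

/-- `μ`, a measure on the σ-algebra `m` of `X(A)`, is a `K`-representing measure for `L` on `m`:
`K ∈ m`, `μ` is supported in `K`, and `L a = ∫ α(a) dμ(α)` for every `a`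
(in particular all these integrals exist). -/
structure IsRepresenting {m : MeasurableSpace (CharSpace A)} (K : Set (CharSpace A))
    (L : A →ₗ[ℝ] ℝ) (μ : Measure (CharSpace A)) : Prop where
  measurableSet : MeasurableSet K
  supported : μ Kᶜ = 0
  integrable : ∀ a : A, Integrable (fun α : CharSpace A => α a) μ
  integral_eq : ∀ a : A, ∫ α : CharSpace A, α a ∂μ = L a

/-- The restriction `L↾S` of a linear functional to a subalgebra. -/
def restrictFunctional (L : A →ₗ[ℝ] ℝ) (S : Subalgebra ℝ A) : S →ₗ[ℝ] ℝ :=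
  L.comp S.val.toLinearMap

/-- Exactness of a family of Borel measures `μ_S` on `X(S)`, `S ∈ J`:
`π_{S,T} # μ_T = μ_S` whenever `S ⊆ T` in `J`. -/
def IsExact {J : Set (Subalgebra ℝ A)} (μ : ∀ S : J, Measure (CharSpace S.1)) : Prop :=
  ∀ (S T : J) (h : S.1 ≤ T.1), (μ T).map (restr h) = μ S

/-- Thickness: each `π_S(X(A))` is thick with respect to `μ_S`, i.e. every Borel set disjoint
from it is `μ_S`-null. -/
def IsThick {J : Set (Subalgebra ℝ A)} (μ : ∀ S : J, Measure (CharSpace S.1)) : Prop :=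
  ∀ (S : J) (M : Set (CharSpace S.1)), MeasurableSet M → range (proj S.1) ∩ M = ∅ → μ S M = 0

/-- `{ν_T : T ∈ Λ}` is the system corresponding to `{μ_S : S ∈ I}`: every `ν_T` is a Radon
probability measure on `X(T)` with `π_{S,T} # ν_T = μ_S` for all `S ∈ I` with `S ⊆ T`. -/
structure IsCorresponding (μ : ∀ S : fgSub A, Measure (CharSpace S.1))
    (ν : ∀ T : cgSub A, Measure (CharSpace T.1)) : Prop where
  isProbability : ∀ T, IsProbabilityMeasure (ν T)
  isRadon : ∀ T, IsRadon (ν T)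
  map_eq : ∀ (S : fgSub A) (T : cgSub A) (h : S.1 ≤ T.1), (ν T).map (restr h) = μ S

/-- Prokhorov's condition: for every `ε > 0` there is a compact `C ⊆ X(A)` with
`μ_S(π_S(C)) ≥ 1 - ε` for all `S ∈ I`. -/
def Prokhorov (μ : ∀ S : fgSub A, Measure (CharSpace S.1)) : Prop :=
  ∀ ε : ℝ, 0 < ε → ∃ C : Set (CharSpace A), IsCompact C ∧
    ∀ S : fgSub A, 1 - ENNReal.ofReal ε ≤ μ S (proj S.1 '' C)

/-- Quadratic modules: `1 ∈ Q`, `Q + Q ⊆ Q` and `a² Q ⊆ Q` for every `a`. -/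
structure IsQuadraticModule (Q : Set A) : Prop where
  one_mem : (1 : A) ∈ Q
  add_mem : ∀ p ∈ Q, ∀ q ∈ Q, p + q ∈ Q
  sq_mul_mem : ∀ a : A, ∀ q ∈ Q, a ^ 2 * q ∈ Q

/-- `Q` is generated, as a quadratic module, by a countable set. -/
def IsCountablyGenerated (Q : Set A) : Prop :=
  ∃ G : Set A, G.Countable ∧ IsLeast {M : Set A | IsQuadraticModule M ∧ G ⊆ M} Q

/-- `K_Q = {α ∈ X(A) : α(a) ≥ 0 for all a ∈ Q}`. -/
def nonnegSet (Q : Set A) : Set (CharSpace A) := {α | ∀ a ∈ Q, 0 ≤ α a}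

/-- `K_{Q ∩ S} = {α ∈ X(S) : α(a) ≥ 0 for all a ∈ Q ∩ S}`, a subset of `X(S)`. -/
def nonnegSetRestr (Q : Set A) (S : Subalgebra ℝ A) : Set (CharSpace S) :=
  {α | ∀ a : S, (a : A) ∈ Q → 0 ≤ α a}

end Systems

end CharMoment

end

open Filter BoundedContinuousFunction

namespace CharMoment

/-! ### Topology of character spaces -/

section Topological

variable {A : Type*} [CommRing A] [Algebra ℝ A]

/-! A closed `K` is cut out by the elements nonnegative on it: a character outside `K` is separated
from `K` by a sum of squares minus a constant.

For (i), a countably generated `T` has Polish `X(T)`, closed in a countable power of `ℝ`, so finite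
Borel measures there are Radon. Countably many countably generated subalgebras lie in a common one,
so `Σ_I` consists exactly of the preimages of Borel sets of the `X(T)`, `T ∈ Λ`. A measure on `Σ_I`
therefore amounts to an exact family over `Λ`, and thickness says that the mass of a cylinder
depends only on the cylinder, not on its base (`IsThick.measure_le`, `exists_measure_map_proj_eq`).
If `Q` is generated by a countable set, `K_Q` is a countable intersection of cylinders of full
measure.

For (ii), a Radon measure pushes forward, and its large compact sets give Prokhorov's condition.
Conversely, the `μ_S` need not be compatible, so a limit point is taken instead. All `X(S)` are
mapped into the Stone–Čech compactification of `A → ℝ`, where an ultrafilter limit exists by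
Riesz–Markov. Prokhorov's condition concentrates the limit on compact subsets of `X(A)`, so it
descends to a Radon measure (`Prokhorov.exists_isRadon_tendsto`). Only bounded functions pass to the
limit directly; the bound `L (a ^ 2)` on second moments, uniform in `S`, recovers the integrals of
`α a`. -/

theorem isEmbedding_coe :
    IsEmbedding (fun (α : CharSpace A) (a : A) => α a) :=
  ⟨⟨rfl⟩, fun _ _ h => AlgHom.ext (congrFun h)⟩

theorem continuous_eval (a : A) : Continuous (fun α : CharSpace A => α a) :=
  (continuous_apply a).comp isEmbedding_coe.continuous

theorem measurable_eval (a : A) : Measurable (fun α : CharSpace A => α a) :=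
  (continuous_eval a).measurable

theorem continuous_iff_eval {X : Type*} [TopologicalSpace X] {f : X → CharSpace A} :
    Continuous f ↔ ∀ a, Continuous fun x => f x a := by
  rw [isEmbedding_coe.continuous_iff, continuous_pi_iff]
  rfl

instance : T2Space (CharSpace A) := isEmbedding_coe.t2Space

theorem continuous_proj (S : Subalgebra ℝ A) : Continuous (proj S) :=
  continuous_iff_eval.2 fun a => continuous_eval (a : A)

theorem continuous_restr {S T : Subalgebra ℝ A} (h : S ≤ T) : Continuous (restr h) :=
  continuous_iff_eval.2 fun a => continuous_eval (Subalgebra.inclusion h a)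

theorem measurable_restr {S T : Subalgebra ℝ A} (h : S ≤ T) : Measurable (restr h) :=
  (continuous_restr h).measurable

theorem restr_refl {S : Subalgebra ℝ A} (h : S ≤ S) : restr h = id := rfl

theorem isClosed_nonnegSet (Q : Set A) : IsClosed (nonnegSet Q) := by
  simp only [nonnegSet, ofPred_forall]
  exact isClosed_biInter fun a _ => isClosed_le continuous_const (continuous_eval a)

theorem isClosed_nonnegSetRestr (Q : Set A) (S : Subalgebra ℝ A) :
    IsClosed (nonnegSetRestr Q S) := by
  simp only [nonnegSetRestr, ofPred_forall]
  exact isClosed_iInter fun a => isClosed_iInter fun _ =>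
    isClosed_le continuous_const (continuous_eval a)

/-- Evaluation at a generating family embeds the character space as a closed set (the zero set of
the relations between the generators). -/
theorem isClosedEmbedding_eval_generators {B ι : Type*} [CommRing B] [Algebra ℝ B] (s : ι → B)
    (hs : Algebra.adjoin ℝ (range s) = ⊤) :
    IsClosedEmbedding (fun (α : CharSpace B) (i : ι) => α (s i)) := by
  have he : Function.Surjective (MvPolynomial.aeval s : MvPolynomial ι ℝ →ₐ[ℝ] B) := by
    rw [← AlgHom.range_eq_top, ← Algebra.adjoin_range_eq_range_aeval, hs]
  have hα : ∀ (α : CharSpace B) p, α (MvPolynomial.aeval s p) =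
      MvPolynomial.eval (fun i => α (s i)) p := by
    intro α p
    rw [← MvPolynomial.coe_aeval_eq_eval]
    exact MvPolynomial.comp_aeval_apply s α p
  choose p hp using he
  have hcont : Continuous (fun (α : CharSpace B) (i : ι) => α (s i)) :=
    continuous_pi fun i => continuous_eval (s i)
  -- All evaluations are recovered continuously from the values on generators through chosen
  -- polynomial expressions `p b`.
  have hF : Continuous (fun (x : ι → ℝ) (b : B) => MvPolynomial.eval x (p b)) :=
    continuous_pi fun b => MvPolynomial.continuous_eval (p b)
  have hcomp : (fun (x : ι → ℝ) (b : B) => MvPolynomial.eval x (p b)) ∘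
      (fun (α : CharSpace B) (i : ι) => α (s i)) = fun α b => α b := by
    funext α b
    simp only [Function.comp_apply]
    rw [← hα, hp]
  refine ⟨IsEmbedding.of_comp hcont hF (hcomp ▸ isEmbedding_coe), ?_⟩
  have hrange : range (fun (α : CharSpace B) (i : ι) => α (s i)) =
      ⋂ q : MvPolynomial ι ℝ, ⋂ _ : MvPolynomial.aeval s q = 0,
        {x | MvPolynomial.eval x q = 0} := by
    ext x
    simp only [mem_range, mem_iInter, mem_ofPred_eq]
    constructor
    · rintro ⟨α, rfl⟩ q hq
      rw [← hα, hq, map_zero]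
    · intro hx
      -- A point satisfying all relations defines an evaluation that factors through the quotient by
      -- `ker e`, which is `B`.
      let e : MvPolynomial ι ℝ →ₐ[ℝ] B := MvPolynomial.aeval s
      have he : Function.Surjective e := fun b => ⟨p b, hp b⟩
      let φ := Ideal.Quotient.liftₐ (RingHom.ker e)
        (MvPolynomial.aeval x : MvPolynomial ι ℝ →ₐ[ℝ] ℝ) (fun q hq => by
          simpa [MvPolynomial.aeval_eq_eval] using hx q hq)
      refine ⟨φ.comp (Ideal.quotientKerAlgEquivOfSurjective he).symm.toAlgHom, ?_⟩
      funext i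
      have : (Ideal.quotientKerAlgEquivOfSurjective he).symm (s i) =
          Ideal.Quotient.mk _ (MvPolynomial.X i) := by
        rw [AlgEquiv.symm_apply_eq]
        simp [e]
      simp [this, φ]
  rw [hrange]
  exact isClosed_iInter fun q => isClosed_iInter fun _ =>
    isClosed_eq (MvPolynomial.continuous_eval q) continuous_const

theorem isClosedEmbedding_eval_adjoin (G : Set A) :
    IsClosedEmbedding (fun (α : CharSpace (Algebra.adjoin ℝ G)) (g : G) =>
      α ⟨g, Algebra.subset_adjoin g.2⟩) := by
  refine isClosedEmbedding_eval_generators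
    (fun g : G => (⟨g, Algebra.subset_adjoin g.2⟩ : Algebra.adjoin ℝ G)) ?_
  have hrange : range (fun g : G => (⟨g, Algebra.subset_adjoin g.2⟩ : Algebra.adjoin ℝ G)) =
      Subtype.val ⁻¹' G := by
    ext x
    exact ⟨fun ⟨g, hg⟩ => hg ▸ g.2, fun hx => ⟨⟨x, hx⟩, rfl⟩⟩
  rw [hrange]
  exact Algebra.adjoin_adjoin_coe_preimage

theorem polishSpace_of_mem_cgSub {T : Subalgebra ℝ A} (hT : T ∈ cgSub A) :
    PolishSpace (CharSpace T) := by
  obtain ⟨G, hG, rfl⟩ := hT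
  have := hG.to_subtype
  exact (isClosedEmbedding_eval_adjoin G).polishSpace

/-- For countably generated `T`, the Borel σ-algebra of `X(T)` is generated by evaluations. -/
theorem measurable_of_forall_eval {T : Subalgebra ℝ A} (hT : T ∈ cgSub A) {Ω : Type*}
    [MeasurableSpace Ω] {f : Ω → CharSpace T} (hf : ∀ a : T, Measurable fun x => f x a) :
    Measurable f := by
  obtain ⟨G, hG, rfl⟩ := hT
  have := hG.to_subtype
  rw [(isClosedEmbedding_eval_adjoin G).measurableEmbedding.measurable_comp_iff.symm]
  exact measurable_pi_lambda _ fun g => hf _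

theorem fgSub_subset_cgSub : fgSub A ⊆ cgSub A := by
  rintro S ⟨t, rfl⟩
  exact ⟨t, t.countable_toSet, rfl⟩

theorem adjoin_singleton_mem_fgSub (a : A) : Algebra.adjoin ℝ {a} ∈ fgSub A :=
  ⟨{a}, by simp⟩

theorem exists_mem_cgSub_forall_le {T : ℕ → Subalgebra ℝ A} (hT : ∀ n, T n ∈ cgSub A) :
    ∃ U ∈ cgSub A, ∀ n, T n ≤ U := by
  choose G hG hGT using hT
  refine ⟨_, ⟨⋃ n, G n, countable_iUnion hG, rfl⟩, fun n => ?_⟩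
  rw [← hGT n]
  exact Algebra.adjoin_mono (subset_iUnion G n)

theorem exists_mem_cgSub_le_le {S T : Subalgebra ℝ A} (hS : S ∈ cgSub A) (hT : T ∈ cgSub A) :
    ∃ U ∈ cgSub A, S ≤ U ∧ T ≤ U := by
  obtain ⟨U, hU, h⟩ := exists_mem_cgSub_forall_le (T := fun n => if n = 0 then S else T)
    (fun n => by split_ifs <;> assumption)
  exact ⟨U, hU, by simpa using h 0, by simpa using h 1⟩

/-- Every closed set of characters is the nonnegativity set of a quadratic module. -/
theorem exists_isQuadraticModule_eq_nonnegSet {K : Set (CharSpace A)} (hK : IsClosed K) :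
    ∃ Q : Set A, IsQuadraticModule Q ∧ K = nonnegSet Q := by
  refine ⟨{a | ∀ α ∈ K, 0 ≤ α a}, ⟨fun α _ => by simp, fun p hp q hq α hα => ?_,
    fun a q hq α hα => ?_⟩, Subset.antisymm (fun α hα a ha => ha α hα) fun α hα => ?_⟩
  · rw [map_add]
    exact add_nonneg (hp α hα) (hq α hα)
  · rw [map_mul, map_pow]
    exact mul_nonneg (sq_nonneg _) (hq α hα)
  · by_contra hαK
    have hU : Kᶜ ∈ 𝓝 α := hK.isOpen_compl.mem_nhds hαK
    rw [isEmbedding_coe.nhds_eq_comap, mem_comap] at hU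
    obtain ⟨V, hV, hVK⟩ := hU
    rw [nhds_pi, Filter.mem_pi] at hV
    obtain ⟨F, hF, t, ht, htV⟩ := hV
    choose! ε hε hεt using fun a => Metric.mem_nhds_iff.1 (ht a)
    classical
    obtain ⟨δ, hδ, hδε⟩ : ∃ δ > 0, ∀ a ∈ F, δ ≤ ε a := by
      obtain h | h := F.eq_empty_or_nonempty
      · exact ⟨1, one_pos, by simp [h]⟩
      · obtain ⟨a, -, ha⟩ := exists_min_image F ε hF h
        exact ⟨ε a, hε a, ha⟩
    -- `q` is negative at `α`; a character where `q` is negative is within `δ` of `α` on all of `F`,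
    -- hence in the neighbourhood of `α` missing `K`.
    let q : A := ∑ a ∈ hF.toFinset, (a - algebraMap ℝ A (α a)) ^ 2 - algebraMap ℝ A (δ ^ 2)
    have hq : ∀ β : CharSpace A, β q = ∑ a ∈ hF.toFinset, (β a - α a) ^ 2 - δ ^ 2 := by
      intro β
      simp only [q, map_sub, map_sum, map_pow, AlgHom.commutes, Algebra.algebraMap_self,
        RingHom.id_apply]
    have hneg : α q < 0 := by
      rw [hq]
      simp only [sub_self]
      simp
      positivity
    refine absurd (hα q fun β hβ => ?_) (not_le.2 hneg)
    rw [hq]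
    by_contra hlt
    push Not at hlt
    refine hVK (htV fun a ha => hεt a ?_) hβ
    have hsum := Finset.single_le_sum (f := fun a => (β a - α a) ^ 2)
      (fun i _ => sq_nonneg _) (hF.mem_toFinset.2 ha)
    rw [Metric.mem_ball, Real.dist_eq]
    refine lt_of_lt_of_le (abs_lt_of_sq_lt_sq ?_ hδ.le) (hδε a ha)
    linarith

end Topological

end CharMoment

namespace CharMoment

/-! ### The cylinder σ-algebra and thick families -/

section Cylinder

variable {A : Type*} [CommRing A] [Algebra ℝ A]

theorem IsRepresenting.isProbabilityMeasure {m : MeasurableSpace (CharSpace A)}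
    {K : Set (CharSpace A)} {L : A →ₗ[ℝ] ℝ} {μ : Measure (CharSpace A)}
    (h : IsRepresenting K L μ) (hL : L 1 = 1) : IsProbabilityMeasure μ := by
  have := h.integral_eq 1
  simp only [map_one, integral_const, smul_eq_mul, mul_one, hL] at this
  exact ⟨(ENNReal.toReal_eq_one_iff _).1 this⟩

theorem IsRepresenting.map_proj {m : MeasurableSpace (CharSpace A)}
    {K : Set (CharSpace A)} {L : A →ₗ[ℝ] ℝ} {μ : Measure (CharSpace A)}
    (h : IsRepresenting K L μ) {S : Subalgebra ℝ A} (hS : Measurable (proj S))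
    {C : Set (CharSpace S)} (hC : MeasurableSet C) (hμC : μ (proj S ⁻¹' C)ᶜ = 0) :
    IsRepresenting C (restrictFunctional L S) (μ.map (proj S)) where
  measurableSet := hC
  supported := by
    rw [Measure.map_apply hS hC.compl]
    exact hμC
  integrable a := by
    rw [integrable_map_measure (measurable_eval a).aestronglyMeasurable hS.aemeasurable]
    exact h.integrable a
  integral_eq a := by
    rw [integral_map hS.aemeasurable (measurable_eval a).aestronglyMeasurable]
    exact h.integral_eq a

theorem measurable_proj_of_mem_fgSub {S : Subalgebra ℝ A} (hS : S ∈ fgSub A) :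
    Measurable[cylinderSigma A] (proj S) :=
  measurable_iff_comap_le.2
    (le_iSup (fun S : fgSub A => MeasurableSpace.comap (proj S.1) (borel _)) ⟨S, hS⟩)

theorem measurable_eval_cylinderSigma (a : A) :
    Measurable[cylinderSigma A] (fun α : CharSpace A => α a) :=
  (measurable_eval (⟨a, Algebra.self_mem_adjoin_singleton ℝ a⟩ : Algebra.adjoin ℝ {a})).comp
    (measurable_proj_of_mem_fgSub (adjoin_singleton_mem_fgSub a))

theorem measurable_proj_of_mem_cgSub {T : Subalgebra ℝ A} (hT : T ∈ cgSub A) :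
    Measurable[cylinderSigma A] (proj T) :=
  @measurable_of_forall_eval _ _ _ _ hT _ (cylinderSigma A) _
    fun a => measurable_eval_cylinderSigma (a : A)

/-- The cylinder sets over countably generated subalgebras already form a σ-algebra. -/
theorem measurableSet_cylinderSigma_iff {s : Set (CharSpace A)} :
    MeasurableSet[cylinderSigma A] s ↔
      ∃ T : cgSub A, ∃ B : Set (CharSpace T.1), MeasurableSet B ∧ proj T.1 ⁻¹' B = s := by
  refine ⟨fun hs => ?_, ?_⟩
  · let m : MeasurableSpace (CharSpace A) :=
      { MeasurableSet' := fun s =>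
          ∃ T : cgSub A, ∃ B : Set (CharSpace T.1), MeasurableSet B ∧ proj T.1 ⁻¹' B = s
        measurableSet_empty :=
          ⟨⟨_, fgSub_subset_cgSub (adjoin_singleton_mem_fgSub 0)⟩, ∅, .empty, rfl⟩
        measurableSet_compl := by
          rintro _ ⟨T, B, hB, rfl⟩
          exact ⟨T, Bᶜ, hB.compl, rfl⟩
        measurableSet_iUnion := by
          intro f hf
          choose T B hB hBf using hf
          -- Countable unions are taken inside one `X(U)`; finitely generated subalgebras would not
          -- suffice here.
          obtain ⟨U, hU, hTU⟩ := exists_mem_cgSub_forall_le fun n => (T n).2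
          refine ⟨⟨U, hU⟩, ⋃ n, restr (hTU n) ⁻¹' B n,
            .iUnion fun n => measurable_restr _ (hB n), ?_⟩
          rw [preimage_iUnion]
          exact iUnion_congr fun n => hBf n }
    have hm : cylinderSigma A ≤ m := by
      refine iSup_le fun S => ?_
      rintro _ ⟨B, hB, rfl⟩
      exact ⟨⟨S.1, fgSub_subset_cgSub S.2⟩, B, hB, rfl⟩
    exact hm s hs
  · rintro ⟨T, B, hB, rfl⟩
    exact measurable_proj_of_mem_cgSub T.2 hB

/-- Over a common `U`, the difference of the two pulled-back bases misses the image of `X(A)`, so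
thickness makes it null. -/
theorem IsThick.measure_le {ν : ∀ T : cgSub A, Measure (CharSpace T.1)} (hthick : IsThick ν)
    (hexact : IsExact ν) {S T : cgSub A} {B : Set (CharSpace S.1)} {C : Set (CharSpace T.1)}
    (hB : MeasurableSet B) (hC : MeasurableSet C) (h : proj S.1 ⁻¹' B ⊆ proj T.1 ⁻¹' C) :
    ν S B ≤ ν T C := by
  obtain ⟨U, hU, hSU, hTU⟩ := exists_mem_cgSub_le_le S.2 T.2
  rw [← hexact S ⟨U, hU⟩ hSU, ← hexact T ⟨U, hU⟩ hTU,
    Measure.map_apply (measurable_restr _) hB, Measure.map_apply (measurable_restr _) hC]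
  refine measure_mono_ae (ae_le_set.2 (hthick _ _
    ((measurable_restr _ hB).diff (measurable_restr _ hC)) ?_))
  rw [← disjoint_iff_inter_eq_empty, Set.disjoint_left]
  rintro _ ⟨α, rfl⟩ ⟨h1, h2⟩
  exact h2 (h h1)

/-- A thick exact family over the countably generated subalgebras is the family of images of a
measure on the cylinder σ-algebra. -/
theorem exists_measure_map_proj_eq {ν : ∀ T : cgSub A, Measure (CharSpace T.1)}
    (hthick : IsThick ν) (hexact : IsExact ν) :
    ∃ μ : @Measure (CharSpace A) (cylinderSigma A),
      ∀ T : cgSub A, @Measure.map _ _ (cylinderSigma A) _ (proj T.1) μ = ν T := by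
  choose T B hB hBs using fun (s : Set (CharSpace A)) (hs : MeasurableSet[cylinderSigma A] s) =>
    measurableSet_cylinderSigma_iff.1 hs
  -- Independence of the chosen representation of the cylinder.
  have hval : ∀ s hs (U : cgSub A) (E : Set (CharSpace U.1)), MeasurableSet E →
      proj U.1 ⁻¹' E = s → ν (T s hs) (B s hs) = ν U E := by
    intro s hs U E hE hEs
    exact le_antisymm (hthick.measure_le hexact (hB s hs) hE (by rw [hBs, hEs]))
      (hthick.measure_le hexact hE (hB s hs) (by rw [hBs, hEs]))
  let μ : @Measure (CharSpace A) (cylinderSigma A) :=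
    @Measure.ofMeasurable _ (cylinderSigma A) (fun s hs => ν (T s hs) (B s hs))
      (by
        rw [hval ∅ _ (T ∅ (@MeasurableSet.empty _ (cylinderSigma A))) ∅ .empty preimage_empty,
          measure_empty])
      (by
        intro f hf hd
        obtain ⟨U, hU, hTU⟩ := exists_mem_cgSub_forall_le fun n => (T (f n) (hf n)).2
        have hE : ∀ n, MeasurableSet (restr (hTU n) ⁻¹' B (f n) (hf n)) :=
          fun n => measurable_restr _ (hB _ _)
        have hEf : ∀ n, proj U ⁻¹' (restr (hTU n) ⁻¹' B (f n) (hf n)) = f n := fun n => hBs _ _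
        -- Disjoint cylinders have bases in `X(U)` that are disjoint only on the image of `X(A)`;
        -- thickness gives almost disjointness, which is enough for additivity.
        rw [hval _ _ ⟨U, hU⟩ (⋃ n, restr (hTU n) ⁻¹' B (f n) (hf n)) (.iUnion hE)
          (by rw [preimage_iUnion]; exact iUnion_congr hEf), measure_iUnion₀ ?_
          fun n => (hE n).nullMeasurableSet]
        · exact tsum_congr fun n => (hval _ _ ⟨U, hU⟩ _ (hE n) (hEf n)).symm
        · intro i j hij
          refine hthick _ _ ((hE i).inter (hE j)) ?_
          rw [← disjoint_iff_inter_eq_empty, Set.disjoint_left]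
          rintro _ ⟨α, rfl⟩ ⟨h1, h2⟩
          exact Set.disjoint_left.1 (hd hij) ((hEf i).subset h1) ((hEf j).subset h2))
  refine ⟨μ, fun U => Measure.ext fun E hE => ?_⟩
  have hmU := measurable_proj_of_mem_cgSub U.2
  rw [@Measure.map_apply _ _ (cylinderSigma A) _ _ _ hmU _ hE]
  exact (@Measure.ofMeasurable_apply _ (cylinderSigma A) _ _ _ _ (hmU hE)).trans
    (hval _ _ U E hE rfl)

theorem isRadon_of_mem_cgSub {T : Subalgebra ℝ A} (hT : T ∈ cgSub A)
    (μ : Measure (CharSpace T)) [IsFiniteMeasure μ] : IsRadon μ := by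
  have := polishSpace_of_mem_cgSub hT
  exact ⟨IsFiniteMeasure.toIsLocallyFiniteMeasure μ, inferInstance⟩

theorem exists_cylinder_representing_iff (L : A →ₗ[ℝ] ℝ) (hL : L 1 = 1) (Q : Set A) :
    (∃ μ : @Measure (CharSpace A) (cylinderSigma A), IsRepresenting univ L μ ∧
        ∀ S : fgSub A, μ (proj S.1 ⁻¹' nonnegSetRestr Q S.1)ᶜ = 0) ↔
      ∃ μ : ∀ S : fgSub A, Measure (CharSpace S.1),
        (∀ S, IsRadon (μ S) ∧
          IsRepresenting (nonnegSetRestr Q S.1) (restrictFunctional L S.1) (μ S)) ∧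
        IsExact μ ∧
        ∃ ν : ∀ T : cgSub A, Measure (CharSpace T.1),
          IsCorresponding μ ν ∧ IsExact ν ∧ IsThick ν := by
  let _ : MeasurableSpace (CharSpace A) := cylinderSigma A
  constructor
  · rintro ⟨μ, hμ, hsupp⟩
    have hprob := hμ.isProbabilityMeasure hL
    have hmap : ∀ {S T : Subalgebra ℝ A} (h : S ≤ T), T ∈ cgSub A →
        (μ.map (proj T)).map (restr h) = μ.map (proj S) := fun h hT =>
      Measure.map_map (measurable_restr h) (measurable_proj_of_mem_cgSub hT)
    have hP : ∀ T ∈ cgSub A, IsProbabilityMeasure (μ.map (proj T)) := fun T hT =>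
      Measure.isProbabilityMeasure_map (measurable_proj_of_mem_cgSub hT).aemeasurable
    refine ⟨fun S => μ.map (proj S.1), fun S => ⟨?_, ?_⟩, fun S T h => ?_,
      fun T => μ.map (proj T.1), ⟨fun T => hP T T.2, fun T => ?_, fun S T h => hmap h T.2⟩,
      fun S T h => hmap h T.2, fun T M hM hdisj => ?_⟩
    · have := hP S (fgSub_subset_cgSub S.2)
      exact isRadon_of_mem_cgSub (fgSub_subset_cgSub S.2) _
    · exact hμ.map_proj (measurable_proj_of_mem_fgSub S.2)
        (isClosed_nonnegSetRestr Q S.1).measurableSet (hsupp S)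
    · exact hmap h (fgSub_subset_cgSub T.2)
    · have := hP T T.2
      exact isRadon_of_mem_cgSub T.2 _
    · rw [Measure.map_apply (measurable_proj_of_mem_cgSub T.2) hM]
      rw [preimage_eq_empty, measure_empty]
      rw [disjoint_iff_inter_eq_empty, inter_comm, hdisj]
  · rintro ⟨μ, hμ, -, ν, hcorr, hexact, hthick⟩
    obtain ⟨ρ, hρ⟩ := exists_measure_map_proj_eq hthick hexact
    have hmap : ∀ S : fgSub A, ρ.map (proj S.1) = μ S := by
      intro S
      -- `S` itself belongs to `Λ`, and the correspondence with `T = S` says `ν S = μ S`.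
      rw [hρ ⟨S.1, fgSub_subset_cgSub S.2⟩,
        ← hcorr.map_eq S ⟨S.1, fgSub_subset_cgSub S.2⟩ le_rfl, restr_refl, Measure.map_id]
    have heval : ∀ a : A, Integrable (fun α : CharSpace A => α a) ρ ∧
        ∫ α : CharSpace A, α a ∂ρ = L a := by
      intro a
      let S : fgSub A := ⟨_, adjoin_singleton_mem_fgSub a⟩
      let b : S.1 := ⟨a, Algebra.self_mem_adjoin_singleton ℝ a⟩
      have hm := measurable_proj_of_mem_fgSub S.2
      constructor
      · have := (hμ S).2.integrable b
        rw [← hmap, integrable_map_measure (measurable_eval b).aestronglyMeasurable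
          hm.aemeasurable] at this
        exact this
      · have := (hμ S).2.integral_eq b
        rw [← hmap, integral_map hm.aemeasurable (measurable_eval b).aestronglyMeasurable] at this
        exact this
    refine ⟨ρ, ⟨.univ, by simp, fun a => (heval a).1, fun a => (heval a).2⟩, fun S => ?_⟩
    have := (hμ S).2.supported
    rw [← hmap, Measure.map_apply (measurable_proj_of_mem_fgSub S.2)
      (hμ S).2.measurableSet.compl] at this
    exact this

theorem nonnegSet_eq_biInter_of_isLeast {Q G : Set A}
    (hG : IsLeast {M : Set A | IsQuadraticModule M ∧ G ⊆ M} Q) :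
    nonnegSet Q = ⋂ g ∈ G, {α : CharSpace A | 0 ≤ α g} := by
  ext α
  simp only [mem_iInter]
  refine ⟨fun h g hg => h g (hG.1.2 hg), fun h => ?_⟩
  exact hG.2 (show {a | 0 ≤ α a} ∈ _ from ⟨⟨by simp, fun p hp q hq => by simpa using add_nonneg hp hq,
    fun a q hq => by simpa using mul_nonneg (sq_nonneg (α a)) hq⟩, h⟩)

theorem IsRepresenting.nonnegSet_of_isCountablyGenerated {L : A →ₗ[ℝ] ℝ} {Q : Set A}
    (hQ : IsCountablyGenerated Q) {μ : @Measure (CharSpace A) (cylinderSigma A)}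
    (hμ : IsRepresenting univ L μ)
    (hsupp : ∀ S : fgSub A, μ (proj S.1 ⁻¹' nonnegSetRestr Q S.1)ᶜ = 0) :
    IsRepresenting (nonnegSet Q) L μ := by
  let _ : MeasurableSpace (CharSpace A) := cylinderSigma A
  obtain ⟨G, hGc, hG⟩ := hQ
  have hGQ : G ⊆ Q := hG.1.2
  refine ⟨?_, ?_, hμ.integrable, hμ.integral_eq⟩ <;> rw [nonnegSet_eq_biInter_of_isLeast hG]
  · exact .biInter hGc fun g _ => measurable_eval_cylinderSigma g measurableSet_Ici
  · simp only [compl_iInter]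
    refine (measure_biUnion_null_iff hGc).2 fun g hg => measure_mono_null ?_
      (hsupp ⟨_, adjoin_singleton_mem_fgSub g⟩)
    exact compl_subset_compl.2 fun α hα =>
      hα ⟨g, Algebra.self_mem_adjoin_singleton ℝ g⟩ (hGQ hg)

end Cylinder

end CharMoment

/-! ### Descent of measures along embeddings, and limits on compact spaces -/

/-- A finite regular measure on a Hausdorff space, almost carried by compact subsets of an embedded
subspace, comes from an inner regular measure on that subspace. -/
theorem Topology.IsEmbedding.exists_innerRegular_map_eq {X Z : Type*} [TopologicalSpace X]
    [MeasurableSpace X] [BorelSpace X] [TopologicalSpace Z] [T2Space Z] [MeasurableSpace Z]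
    [BorelSpace Z] {ι : X → Z} (hι : IsEmbedding ι) (ρ : Measure Z) [IsFiniteMeasure ρ]
    [ρ.InnerRegular]
    (hρ : ∀ ε : ENNReal, 0 < ε → ∃ C : Set X, IsCompact C ∧ ρ (ι '' C)ᶜ ≤ ε) :
    ∃ ν : Measure X, ν.InnerRegular ∧ ν.map ι = ρ := by
  -- `ι` need not be a measurable embedding, but on each compact `C` it is a closed embedding.
  have hmeas : ∀ {C : Set X}, IsCompact C → ∀ {s : Set X}, MeasurableSet s →
      MeasurableSet (ι '' (s ∩ C)) := by
    intro C hC s hs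
    have := isCompact_iff_compactSpace.1 hC
    have hemb : IsClosedEmbedding (fun x : C => ι x) :=
      (hι.continuous.comp continuous_subtype_val).isClosedEmbedding
        (hι.injective.comp Subtype.val_injective)
    convert hemb.measurableEmbedding.measurableSet_image' (measurable_subtype_coe hs) using 1
    ext z
    constructor
    · rintro ⟨x, ⟨hx, hxC⟩, rfl⟩
      exact ⟨⟨x, hxC⟩, hx, rfl⟩
    · rintro ⟨x, hx, rfl⟩
      exact ⟨x, ⟨hx, x.2⟩, rfl⟩
  have hcompl : ∀ (s C : Set X), ι '' s \ ι '' (s ∩ C) ⊆ (ι '' C)ᶜ := by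
    rintro s C _ ⟨⟨x, hx, rfl⟩, hx'⟩ ⟨y, hy, hxy⟩
    obtain rfl := hι.injective hxy
    exact hx' ⟨y, ⟨hx, hy⟩, rfl⟩
  obtain ⟨ε, -, hεpos, hε⟩ := exists_seq_strictAnti_tendsto' (zero_lt_one (α := ENNReal))
  choose C hC hCε using fun n => hρ (ε n) (hεpos n).1
  have hnull : ∀ s, MeasurableSet s → NullMeasurableSet (ι '' s) ρ := by
    intro s hs
    have hU : MeasurableSet (⋃ n, ι '' (s ∩ C n)) := .iUnion fun n => hmeas (hC n) hs
    -- Up to a null set, `ι '' s` is the countable union of its compactly located pieces, since the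
    -- remainder lies in every `(ι '' C n)ᶜ`.
    refine hU.nullMeasurableSet.congr (Filter.EventuallyLE.antisymm
      (LE.le.eventuallyLE (iUnion_subset fun n => image_mono inter_subset_left)) (ae_le_set.2 ?_))
    refine le_antisymm (ge_of_tendsto' hε fun n => ?_) zero_le
    refine (measure_mono ?_).trans (hCε n)
    exact (sdiff_subset_sdiff_right (subset_iUnion (fun n => ι '' (s ∩ C n)) n)).trans (hcompl s _)
  have hcomap : ∀ s, MeasurableSet s → ρ.comap ι s = ρ (ι '' s) := fun s hs =>
    Measure.comap_apply₀ _ _ hι.injective hnull hs.nullMeasurableSet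
  have hrange : ρ (range ι)ᶜ = 0 :=
    le_antisymm (ge_of_tendsto' hε fun n => (measure_mono
      (compl_subset_compl.2 (image_subset_range ι _))).trans (hCε n)) zero_le
  have : T2Space X := hι.t2Space
  refine ⟨ρ.comap ι, ⟨fun s hs r hr => ?_⟩, Measure.ext fun B hB => ?_⟩
  · rw [hcomap s hs] at hr
    obtain ⟨n, hn⟩ : ∃ n, r < ρ (ι '' (s ∩ C n)) := by
      by_contra! hcon
      have hle : ∀ n, ρ (ι '' s) ≤ r + ε n := fun n => by
        calc ρ (ι '' s) ≤ ρ (ι '' (s ∩ C n) ∪ (ι '' C n)ᶜ) := measure_mono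
              ((sdiff_subset_iff).1 (hcompl s (C n)))
          _ ≤ ρ (ι '' (s ∩ C n)) + ρ (ι '' C n)ᶜ := measure_union_le _ _
          _ ≤ r + ε n := add_le_add (hcon n) (hCε n)
      have hlim := hε.const_add r
      rw [add_zero] at hlim
      exact not_le.2 hr (ge_of_tendsto' hlim hle)
    obtain ⟨D, hDs, hD, hrD⟩ := (hmeas (hC n) hs).exists_lt_isCompact hn
    have hDr : D ⊆ range ι := hDs.trans (image_subset_range _ _)
    have hDc : IsCompact (ι ⁻¹' D) := hι.isInducing.isCompact_preimage' hD hDr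
    refine ⟨ι ⁻¹' D, fun x hx => ?_, hDc, ?_⟩
    · obtain ⟨y, hy, hyx⟩ := hDs hx
      exact hι.injective hyx ▸ hy.1
    · rwa [hcomap _ hDc.measurableSet, image_preimage_eq_of_subset hDr]
  · rw [Measure.map_apply hι.continuous.measurable hB,
      hcomap _ (hι.continuous.measurable hB), image_preimage_eq_inter_range]
    exact measure_inter_conull hrange

/-- The limit along an ultrafilter of probability measures on a compact Hausdorff space, as
functionals on continuous functions, is represented by a regular measure. -/
theorem exists_regular_tendsto_integral {J Z : Type*} [TopologicalSpace Z] [CompactSpace Z]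
    [T2Space Z] [MeasurableSpace Z] [BorelSpace Z] (U : Ultrafilter J) (μ : J → Measure Z)
    [∀ j, IsProbabilityMeasure (μ j)] :
    ∃ ρ : Measure Z, IsFiniteMeasure ρ ∧ ρ.Regular ∧
      ∀ f : C(Z, ℝ), Tendsto (fun j => ∫ z, f z ∂μ j) U (𝓝 (∫ z, f z ∂ρ)) := by
  have hint : ∀ (f : C(Z, ℝ)) j, Integrable f (μ j) := fun f j =>
    (mkOfCompact f).integrable (μ j)
  have hlim : ∀ f : C(Z, ℝ), ∃ l, Tendsto (fun j => ∫ z, f z ∂μ j) U (𝓝 l) := by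
    intro f
    -- All integrals of `f` stay in this compact ball, so the ultrafilter converges.
    have hK : IsCompact (Metric.closedBall (0 : ℝ) ‖f‖) := isCompact_closedBall _ _
    obtain ⟨l, -, hl⟩ := hK.ultrafilter_le_nhds (U.map fun j => ∫ z, f z ∂μ j) (by
      rw [Ultrafilter.coe_map, le_principal_iff, mem_map]
      refine univ_mem' fun j => ?_
      rw [mem_preimage, mem_closedBall_zero_iff]
      simpa using norm_integral_le_of_norm_le_const (μ := μ j)
        (Eventually.of_forall fun z => f.norm_coe_le_norm z))
    exact ⟨l, hl⟩
  choose Λ hΛ using hlim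
  let Φ : CompactlySupportedContinuousMap Z ℝ →ₚ[ℝ] ℝ :=
    { toFun f := Λ f
      map_add' f g := tendsto_nhds_unique (hΛ _) (by
        refine ((hΛ f).add (hΛ g)).congr fun j => ?_
        exact (integral_add (hint f j) (hint g j)).symm)
      map_smul' c f := tendsto_nhds_unique (hΛ _) (by
        refine ((hΛ f).const_mul c).congr fun j => ?_
        exact (integral_const_mul c _).symm)
      monotone' f g hfg := le_of_tendsto_of_tendsto' (hΛ _) (hΛ _) fun j =>
        integral_mono (hint f j) (hint g j) hfg }
  refine ⟨RealRMK.rieszMeasure Φ, inferInstance, inferInstance, fun f => ?_⟩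
  have := RealRMK.integral_rieszMeasure Φ
    ⟨f, HasCompactSupport.of_compactSpace f⟩
  change ∫ z, f z ∂_ = Λ f at this
  rw [this]
  exact hΛ f

namespace CharMoment

/-! ### Radon limit points under Prokhorov's condition -/

section Prokhorov

variable {A : Type*} [CommRing A] [Algebra ℝ A]

open Classical in
/-- Extension of a character of a subalgebra by zero. -/
noncomputable def extendZero {S : Subalgebra ℝ A} (α : CharSpace S) (a : A) : ℝ :=
  if h : a ∈ S then α ⟨a, h⟩ else 0

theorem extendZero_of_mem {S : Subalgebra ℝ A} (α : CharSpace S) {a : A} (h : a ∈ S) :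
    extendZero α a = α ⟨a, h⟩ := dif_pos h

theorem continuous_extendZero (S : Subalgebra ℝ A) :
    Continuous (extendZero : CharSpace S → A → ℝ) := by
  refine continuous_pi fun a => ?_
  by_cases h : a ∈ S
  · simp only [extendZero_of_mem _ h]
    exact continuous_eval _
  · simp only [extendZero, h, dite_false]
    exact continuous_const

instance : Nonempty (fgSub A) := ⟨⟨_, adjoin_singleton_mem_fgSub 0⟩⟩

instance : IsDirectedOrder (fgSub A) :=
  ⟨fun S T => ⟨⟨S.1 ⊔ T.1, S.2.sup T.2⟩, le_sup_left (a := S.1), le_sup_right (a := S.1)⟩⟩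

theorem eventually_mem_fgSub (a : A) : ∀ᶠ S : fgSub A in atTop, a ∈ S.1 :=
  (eventually_ge_atTop ⟨_, adjoin_singleton_mem_fgSub a⟩).mono fun _ hS =>
    hS (Algebra.self_mem_adjoin_singleton ℝ a)

/-- The product uniformity sees finitely many coordinates at a time, and each coordinate is exact
once `a ∈ S`. -/
theorem tendstoUniformlyOn_extendZero_proj (C : Set (CharSpace A)) :
    TendstoUniformlyOn (fun (S : fgSub A) (α : CharSpace A) => extendZero (proj S.1 α))
      (fun α a => α a) atTop C := by
  rw [tendstoUniformlyOn_iff_tendsto, Pi.uniformity, tendsto_iInf]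
  intro a
  rw [tendsto_comap_iff]
  refine (tendsto_diag_uniformity (fun p : fgSub A × CharSpace A => p.2 a) _).congr' ?_
  filter_upwards [(eventually_mem_fgSub a).prod_inl _] with p hp
  simp only [Function.comp_apply, extendZero_of_mem _ hp]
  rfl

theorem eventually_extendZero_proj_mem {C : Set (CharSpace A)} (hC : IsCompact C)
    {V : Set (A → ℝ)} (hV : IsOpen V) (hCV : ∀ α ∈ C, (fun a => α a) ∈ V) :
    ∀ᶠ S : fgSub A in atTop, ∀ α ∈ C, extendZero (proj S.1 α) ∈ V := by
  obtain ⟨E, hE, -, hEV⟩ := lebesgue_number_of_compact_open (hC.image isEmbedding_coe.continuous)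
    hV (image_subset_iff.2 hCV)
  filter_upwards [tendstoUniformlyOn_extendZero_proj C E hE] with S hS α hα
  exact hEV _ (mem_image_of_mem _ hα) (hS α hα)

/-- A family of probability measures on the character spaces of finitely generated subalgebras
satisfying Prokhorov's condition has a Radon limit point on the whole character space. -/
theorem Prokhorov.exists_isRadon_tendsto {μ : ∀ S : fgSub A, Measure (CharSpace S.1)}
    [∀ S, IsProbabilityMeasure (μ S)] (hμ : Prokhorov μ) :
    ∃ ν : Measure (CharSpace A), IsProbabilityMeasure ν ∧ IsRadon ν ∧
      ∃ U : Ultrafilter (fgSub A), (U : Filter (fgSub A)) ≤ atTop ∧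
        ∀ (a : A) (g : ℝ → ℝ) (M : ℝ), Continuous g → (∀ x, |g x| ≤ M) →
          Tendsto (fun S : fgSub A => ∫ α, g (extendZero α a) ∂μ S) U
            (𝓝 (∫ α : CharSpace A, g (α a) ∂ν)) := by
  let _ : MeasurableSpace (StoneCech (A → ℝ)) := borel _
  have _ : BorelSpace (StoneCech (A → ℝ)) := ⟨rfl⟩
  let U : Ultrafilter (fgSub A) := Ultrafilter.of atTop
  have hU : (U : Filter (fgSub A)) ≤ atTop := Ultrafilter.of_le _
  have _ : T35Space (A → ℝ) := {}
  let ι : CharSpace A → StoneCech (A → ℝ) := stoneCechUnit ∘ fun α a => α a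
  have hι : IsEmbedding ι := isEmbedding_stoneCechUnit.comp isEmbedding_coe
  let σ : ∀ S : fgSub A, CharSpace S.1 → StoneCech (A → ℝ) := fun S α =>
    stoneCechUnit (extendZero α)
  have hσ : ∀ S, Continuous (σ S) := fun S =>
    continuous_stoneCechUnit.comp (continuous_extendZero S.1)
  have hP : ∀ S, IsProbabilityMeasure ((μ S).map (σ S)) := fun S =>
    Measure.isProbabilityMeasure_map (hσ S).measurable.aemeasurable
  obtain ⟨ρ, hρf, hρr, hρ⟩ := exists_regular_tendsto_integral U fun S => (μ S).map (σ S)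
  have hlim : ∀ f : C(StoneCech (A → ℝ), ℝ),
      Tendsto (fun S => ∫ α, f (σ S α) ∂μ S) U (𝓝 (∫ z, f z ∂ρ)) := fun f =>
    (hρ f).congr fun S => integral_map (hσ S).measurable.aemeasurable
      f.continuous.aestronglyMeasurable
  have hρ1 : IsProbabilityMeasure ρ := by
    have := hlim 1
    simp only [ContinuousMap.one_apply, integral_const, probReal_univ, smul_eq_mul, mul_one] at this
    exact ⟨(ENNReal.toReal_eq_one_iff _).1 (tendsto_nhds_unique this tendsto_const_nhds)⟩
  have htight : ∀ ε : ENNReal, 0 < ε →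
      ∃ C : Set (CharSpace A), IsCompact C ∧ ρ (ι '' C)ᶜ ≤ ε := by
    intro ε hε
    obtain ⟨δ, hδ, hδε⟩ := ENNReal.lt_iff_exists_nnreal_btwn.1 hε
    obtain ⟨C, hC, hCμ⟩ := hμ δ (by exact_mod_cast hδ)
    refine ⟨C, hC, ?_⟩
    have hιC : IsCompact (ι '' C) := hC.image hι.continuous
    rw [prob_compl_eq_one_sub hιC.measurableSet]
    refine le_trans (tsub_le_iff_left.2 (tsub_le_iff_right.1 ?_)) hδε.le
    -- If `ρ (ι '' C) < 1 - δ`, outer regularity and Urysohn give `f` equal to `1` on `ι '' C` and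
    -- vanishing off an open `O` with `ρ O < 1 - δ`; its integrals against the `μ S` are too large
    -- in the limit.
    by_contra! hlt
    obtain ⟨O, hCO, hO, hρO⟩ := (ι '' C).exists_isOpen_lt_of_lt _ hlt
    obtain ⟨f, hf0, hf1, hf⟩ := exists_continuous_zero_one_of_isClosed hO.isClosed_compl
      hιC.isClosed (disjoint_compl_left_iff_subset.2 hCO)
    have hfO : ∫ z, f z ∂ρ ≤ ρ.real O := by
      rw [← integral_indicator_one hO.measurableSet]
      refine integral_mono ((mkOfCompact f).integrable ρ)
        ((integrable_indicator_iff hO.measurableSet).2 (integrable_const _).integrableOn) fun z => ?_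
      by_cases hz : z ∈ O
      · simpa [hz] using (hf z).2
      · simpa [hz] using (hf0 hz).le
    have hc : ρ.real O < 1 - δ := by
      have := (ENNReal.toReal_lt_toReal (measure_ne_top _ _)
        (ENNReal.sub_ne_top ENNReal.one_ne_top)).2 hρO
      rwa [ENNReal.toReal_sub_of_le _ ENNReal.one_ne_top] at this
      exact (pos_of_gt hρO |> tsub_pos_iff_lt.1).le
    have hc0 : (0 : ℝ) < 1 - δ := measureReal_nonneg.trans_lt hc
    -- `t < 1` leaves room because the extensions by zero only approximate `C`; `ρ O < t * (1 - δ)`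
    -- keeps the contradiction.
    obtain ⟨t, ht, ht1⟩ := exists_between ((div_lt_one hc0).2 hc)
    have ht0 : 0 ≤ t := (div_nonneg measureReal_nonneg hc0.le).trans ht.le
    have hge : t * (1 - δ) ≤ ∫ z, f z ∂ρ := by
      refine ge_of_tendsto (hlim f) (hU ?_)
      have hV : IsOpen {w : A → ℝ | t < f (stoneCechUnit w)} :=
        isOpen_lt continuous_const (f.continuous.comp continuous_stoneCechUnit)
      filter_upwards [eventually_extendZero_proj_mem hC hV fun α hα => by
        have : f (ι α) = 1 := hf1 (mem_image_of_mem _ hα)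
        exact ht1.trans_eq this.symm] with S hS
      have hint : Integrable (fun α => f (σ S α)) (μ S) :=
        ((mkOfCompact f).compContinuous ⟨σ S, hσ S⟩).integrable (μ S)
      refine le_trans ?_ (mul_meas_ge_le_integral_of_nonneg
        (Eventually.of_forall fun α => (hf (σ S α)).1) hint t)
      refine mul_le_mul_of_nonneg_left ?_ ht0
      have h1 : 1 - (δ : ENNReal) ≤ μ S {α | t ≤ f (σ S α)} := by
        have := hCμ S
        rw [ENNReal.ofReal_coe_nnreal] at this
        refine this.trans (measure_mono ?_)
        rintro _ ⟨α, hα, rfl⟩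
        exact (hS α hα).le
      have h2 := ENNReal.toReal_mono (measure_ne_top _ _) h1
      rwa [ENNReal.toReal_sub_of_le _ ENNReal.one_ne_top] at h2
      exact_mod_cast (sub_pos.1 hc0).le
    rw [div_lt_iff₀ hc0] at ht
    exact absurd (hge.trans hfO) (not_le.2 ht)
  obtain ⟨ν, hν, hνρ⟩ := hι.exists_innerRegular_map_eq ρ htight
  have hν1 : IsProbabilityMeasure ν := by
    constructor
    rw [← preimage_univ (f := ι), ← Measure.map_apply hι.continuous.measurable .univ, hνρ,
      measure_univ]
  refine ⟨ν, hν1, ⟨inferInstance, hν⟩, U, hU, fun a g M hg hM => ?_⟩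
  -- With compact codomain, the test function extends to the Stone–Čech compactification.
  let φ : (A → ℝ) → Icc (-M) M := fun w => ⟨g (w a), abs_le.1 (hM _)⟩
  have hφ : Continuous φ := (hg.comp (continuous_apply a)).subtype_mk _
  have := hlim ⟨fun z => (stoneCechExtend hφ z : Icc (-M) M),
    continuous_subtype_val.comp (continuous_stoneCechExtend hφ)⟩
  rw [← hνρ, integral_map hι.continuous.measurable.aemeasurable
    (ContinuousMap.continuous _).aestronglyMeasurable] at this
  simpa only [ContinuousMap.coe_mk, σ, ι, Function.comp_apply, stoneCechExtend_stoneCechUnit, φ]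
    using this

end Prokhorov

end CharMoment

namespace CharMoment

/-! ### Support and moments of the limit measure -/

section Representation

variable {A : Type*} [CommRing A] [Algebra ℝ A]

/-- An inner regular measure giving full mass to `{α | 0 ≤ α q}` for each `q ∈ Q` is carried by
their intersection, even if `Q` is uncountable. -/
theorem measure_compl_nonnegSet {ν : Measure (CharSpace A)} (hν : ν.InnerRegular) {Q : Set A}
    (hQ : ∀ q ∈ Q, ∀ᵐ α : CharSpace A ∂ν, 0 ≤ α q) : ν (nonnegSet Q)ᶜ = 0 := by
  by_contra hne
  obtain ⟨D, hDK, hD, hpos⟩ := (isClosed_nonnegSet Q).measurableSet.compl.exists_lt_isCompact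
    (pos_iff_ne_zero.2 hne)
  refine hpos.ne' (hD.measure_zero_of_nhdsWithin fun α hα => ?_)
  obtain ⟨q, hq, hαq⟩ : ∃ q ∈ Q, α q < 0 := by
    by_contra! h
    exact hDK hα h
  refine ⟨{β | β q < 0}, mem_nhdsWithin_of_mem_nhds
    ((isOpen_lt (continuous_eval q) continuous_const).mem_nhds hαq), ?_⟩
  have := ae_iff.1 (hQ q hq)
  simpa only [not_le] using this

theorem exists_prokhorov_of_isRepresenting {L : A →ₗ[ℝ] ℝ} (hL : L 1 = 1) {Q : Set A}
    {ν : Measure (CharSpace A)} (hR : IsRadon ν) (hν : IsRepresenting (nonnegSet Q) L ν) :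
    ∃ μ : ∀ S : fgSub A, Measure (CharSpace S.1),
      (∀ S, IsRadon (μ S) ∧
        IsRepresenting (nonnegSetRestr Q S.1) (restrictFunctional L S.1) (μ S)) ∧
      Prokhorov μ := by
  have hprob := hν.isProbabilityMeasure hL
  have hm : ∀ S : Subalgebra ℝ A, Measurable (proj S) := fun S => (continuous_proj S).measurable
  refine ⟨fun S => ν.map (proj S.1), fun S => ⟨⟨?_, ?_⟩, ?_⟩, fun ε hε => ?_⟩
  · exact IsFiniteMeasure.toIsLocallyFiniteMeasure _
  · have := hR.innerRegular
    exact Measure.InnerRegular.map_of_continuous (continuous_proj S.1)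
  · refine hν.map_proj (hm S.1) (isClosed_nonnegSetRestr Q S.1).measurableSet
      (measure_mono_null ?_ hν.supported)
    exact compl_subset_compl.2 fun α hα a ha => hα a ha
  · obtain ⟨C, hC, hνC⟩ : ∃ C : Set (CharSpace A), IsCompact C ∧ 1 - ENNReal.ofReal ε ≤ ν C := by
      have hlt : 1 - ENNReal.ofReal ε < ν univ := by
        rw [measure_univ]
        exact ENNReal.sub_lt_self ENNReal.one_ne_top one_ne_zero (by simpa using hε)
      have := hR.innerRegular
      obtain ⟨C, -, hC, h⟩ := MeasurableSet.univ.exists_lt_isCompact hlt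
      exact ⟨C, hC, h.le⟩
    refine ⟨C, hC, fun S => hνC.trans ?_⟩
    rw [Measure.map_apply (hm S.1) (hC.image (continuous_proj S.1)).measurableSet]
    exact measure_mono (subset_preimage_image _ _)

/-- Weak limits preserve integrals of bounded continuous functions of `α a`; support and moments are
reached by truncation, with errors controlled by `L (a ^ 2)` uniformly in `S`. -/
theorem exists_isRepresenting_of_prokhorov {L : A →ₗ[ℝ] ℝ} (hL : L 1 = 1) {Q : Set A}
    {μ : ∀ S : fgSub A, Measure (CharSpace S.1)}
    (hμ : ∀ S, IsRepresenting (nonnegSetRestr Q S.1) (restrictFunctional L S.1) (μ S))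
    (hP : Prokhorov μ) :
    ∃ ν : Measure (CharSpace A), IsRadon ν ∧ IsRepresenting (nonnegSet Q) L ν := by
  have hprob : ∀ S, IsProbabilityMeasure (μ S) := fun S => (hμ S).isProbabilityMeasure hL
  obtain ⟨ν, hν1, hR, U, hU, hlim⟩ := hP.exists_isRadon_tendsto
  have hmem : ∀ (a : A) (g : ℝ → ℝ) (M : ℝ), Continuous g → (∀ x, |g x| ≤ M) →
      ∀ F : Set ℝ, IsClosed F →
        (∀ (S : fgSub A) (h : a ∈ S.1), ∫ α : CharSpace S.1, g (α ⟨a, h⟩) ∂μ S ∈ F) →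
        ∫ α : CharSpace A, g (α a) ∂ν ∈ F := by
    intro a g M hg hM F hF h
    refine hF.mem_of_tendsto (hlim a g M hg hM) (hU ?_)
    filter_upwards [eventually_mem_fgSub a] with S hS
    simpa only [extendZero_of_mem _ hS] using h S hS
  have hbdd : ∀ (a : A) (g : ℝ → ℝ) (M : ℝ), Continuous g → (∀ x, |g x| ≤ M) →
      Integrable (fun α : CharSpace A => g (α a)) ν := fun a g M hg hM =>
    .of_bound (hg.comp (continuous_eval a)).aestronglyMeasurable M
      (Eventually.of_forall fun α => hM _)
  have hsupp : ∀ q ∈ Q, ∀ᵐ α : CharSpace A ∂ν, 0 ≤ α q := by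
    intro q hq
    -- The negative part capped at `1`: a bounded test function vanishing exactly on `[0, ∞)`.
    let g : ℝ → ℝ := fun x => max 0 (min (-x) 1)
    have hg : Continuous g := by fun_prop
    have hg0 : ∀ x, 0 ≤ g x := fun x => le_max_left _ _
    have hg1 : ∀ x, |g x| ≤ 1 := fun x => by
      rw [abs_of_nonneg (hg0 x)]
      exact max_le zero_le_one (min_le_right _ _)
    have h0 : ∫ α : CharSpace A, g (α q) ∂ν = 0 := by
      refine hmem q g 1 hg hg1 {0} isClosed_singleton fun S hS => ?_
      refine integral_eq_zero_of_ae ?_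
      have : ∀ᵐ α ∂μ S, α ∈ nonnegSetRestr Q S.1 := (hμ S).supported
      filter_upwards [this] with α hα
      have : 0 ≤ α ⟨q, hS⟩ := hα ⟨q, hS⟩ hq
      exact max_eq_left ((min_le_left _ _).trans (neg_nonpos.2 this))
    rw [integral_eq_zero_iff_of_nonneg (fun α => hg0 _) (hbdd q g 1 hg hg1)] at h0
    filter_upwards [h0] with α hα
    by_contra! hlt
    have : 0 < g (α q) := lt_max_of_lt_right (lt_min (neg_pos.2 hlt) one_pos)
    exact this.ne' hα
  have hsq_int : ∀ (a : A) (S : fgSub A) (h : a ∈ S.1),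
      Integrable (fun α : CharSpace S.1 => α ⟨a, h⟩ ^ 2) (μ S) ∧
        ∫ α : CharSpace S.1, α ⟨a, h⟩ ^ 2 ∂μ S = L (a ^ 2) := by
    intro a S h
    have h1 := (hμ S).integrable (⟨a, h⟩ ^ 2)
    have h2 := (hμ S).integral_eq (⟨a, h⟩ ^ 2)
    simp only [map_pow] at h1 h2
    exact ⟨h1, h2⟩
  have hsq : ∀ a : A, ∫⁻ α : CharSpace A, ENNReal.ofReal (α a ^ 2) ∂ν ≤
      ENNReal.ofReal (L (a ^ 2)) := by
    intro a
    have htr : ∀ n : ℕ, ∫⁻ α : CharSpace A, ENNReal.ofReal (min (α a ^ 2) n) ∂ν ≤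
        ENNReal.ofReal (L (a ^ 2)) := by
      intro n
      let g : ℝ → ℝ := fun x => min (x ^ 2) n
      have hg : Continuous g := by fun_prop
      have hg0 : ∀ x, 0 ≤ g x := fun x => le_min (sq_nonneg x) n.cast_nonneg
      have hgn : ∀ x, |g x| ≤ n := fun x => by
        rw [abs_of_nonneg (hg0 x)]
        exact min_le_right _ _
      rw [← ofReal_integral_eq_lintegral_ofReal (hbdd a g n hg hgn)
        (Eventually.of_forall fun α => hg0 _)]
      refine ENNReal.ofReal_le_ofReal (hmem a g n hg hgn _ isClosed_Iic fun S hS => ?_)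
      rw [mem_Iic, ← (hsq_int a S hS).2]
      exact integral_mono_of_nonneg (Eventually.of_forall fun α => hg0 _) (hsq_int a S hS).1
        (Eventually.of_forall fun α => min_le_left _ _)
    refine le_of_tendsto' (lintegral_tendsto_of_tendsto_of_monotone (fun n => ?_) ?_ ?_) htr
    · exact (((measurable_eval a).pow_const 2).min measurable_const).ennreal_ofReal.aemeasurable
    · refine Eventually.of_forall fun α m n hmn => ENNReal.ofReal_le_ofReal ?_
      exact min_le_min_left _ (by exact_mod_cast hmn)
    · refine Eventually.of_forall fun α => tendsto_const_nhds.congr' ?_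
      obtain ⟨N, hN⟩ := exists_nat_ge (α a ^ 2)
      filter_upwards [eventually_ge_atTop N] with n hn
      rw [min_eq_left (hN.trans (by exact_mod_cast hn))]
  have hint : ∀ a : A, Integrable (fun α : CharSpace A => α a) ν := by
    intro a
    have h2 : Integrable (fun α : CharSpace A => α a ^ 2) ν := by
      refine ⟨((measurable_eval a).pow_const 2).aestronglyMeasurable, ?_⟩
      rw [hasFiniteIntegral_iff_ofReal (Eventually.of_forall fun α => sq_nonneg _)]
      exact (hsq a).trans_lt ENNReal.ofReal_lt_top
    refine (h2.add (integrable_const 1)).mono' (measurable_eval a).aestronglyMeasurable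
      (Eventually.of_forall fun α => ?_)
    rw [Real.norm_eq_abs, Pi.add_apply, ← sq_abs]
    nlinarith [sq_nonneg (|α a| - 1), abs_nonneg (α a)]
  have heq : ∀ a : A, ∫ α : CharSpace A, α a ∂ν = L a := by
    intro a
    let g : ℕ → ℝ → ℝ := fun n x => max (-n) (min x n)
    have hg : ∀ n, Continuous (g n) := fun n => by fun_prop
    have hgn : ∀ n x, |g n x| ≤ n := fun n x => by
      have : (0 : ℝ) ≤ n := n.cast_nonneg
      exact abs_le.2 ⟨le_max_left _ _, max_le (by linarith) (min_le_right _ _)⟩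
    have hgx : ∀ n x, |g n x| ≤ |x| := fun n x => by
      have : (0 : ℝ) ≤ n := n.cast_nonneg
      have := abs_nonneg x
      refine abs_le.2 ⟨le_max_of_le_right (le_min (neg_abs_le x) (by linarith)),
        max_le (by linarith) ((min_le_left _ _).trans (le_abs_self x))⟩
    have hgeq : ∀ (n : ℕ) (x : ℝ), |x| ≤ n → g n x = x := fun n x hx => by
      simp only [g]
      rw [min_eq_left (abs_le.1 hx).2, max_eq_right (abs_le.1 hx).1]
    -- The error is nonzero only for `|x| > n`, where `2 * |x| ≤ 2 * x ^ 2 / n`; integrated against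
    -- `μ S` it is at most `L (a ^ 2) * (2 / n)`.
    have hgsub : ∀ n : ℕ, 0 < n → ∀ x, |g n x - x| ≤ x ^ 2 * (2 / n) := by
      intro n hn x
      have hn' : (0 : ℝ) < n := by exact_mod_cast hn
      by_cases hx : |x| ≤ n
      · rw [hgeq n x hx, sub_self, abs_zero]
        positivity
      · calc |g n x - x| ≤ |g n x| + |x| := abs_sub _ _
          _ ≤ 2 * |x| := by linarith [hgx n x]
          _ ≤ x ^ 2 * (2 / n) := by
            rw [← sq_abs, mul_div_assoc', le_div_iff₀ hn']
            nlinarith [abs_nonneg x, not_le.1 hx]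
    have h1 : Tendsto (fun n => ∫ α : CharSpace A, g n (α a) ∂ν) atTop
        (𝓝 (∫ α : CharSpace A, α a ∂ν)) := by
      refine tendsto_integral_of_dominated_convergence (fun α => |α a|)
        (fun n => (hbdd a (g n) n (hg n) (hgn n)).aestronglyMeasurable) (hint a).abs
        (fun n => Eventually.of_forall fun α => hgx n _) (Eventually.of_forall fun α => ?_)
      refine tendsto_const_nhds.congr' ?_
      obtain ⟨N, hN⟩ := exists_nat_ge |α a|
      filter_upwards [eventually_ge_atTop N] with n hn
      rw [hgeq n _ (hN.trans (by exact_mod_cast hn))]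
    have h2 : ∀ᶠ n : ℕ in atTop, dist (∫ α : CharSpace A, g n (α a) ∂ν) (L a) ≤
        L (a ^ 2) * (2 / n) := by
      filter_upwards [eventually_gt_atTop 0] with n hn
      refine hmem a (g n) n (hg n) (hgn n) (Metric.closedBall (L a) _) Metric.isClosed_closedBall
        fun S hS => ?_
      have hSa := (hμ S).integrable ⟨a, hS⟩
      have hSL : ∫ α : CharSpace S.1, α ⟨a, hS⟩ ∂μ S = L a := (hμ S).integral_eq ⟨a, hS⟩
      have hSg : Integrable (fun α : CharSpace S.1 => g n (α ⟨a, hS⟩)) (μ S) :=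
        .of_bound ((hg n).comp (continuous_eval _)).aestronglyMeasurable n
          (Eventually.of_forall fun α => hgn n _)
      rw [Metric.mem_closedBall, Real.dist_eq, ← hSL, ← integral_sub hSg hSa,
        ← (hsq_int a S hS).2, ← integral_mul_const]
      exact (abs_integral_le_integral_abs).trans (integral_mono (hSg.sub hSa).abs
        ((hsq_int a S hS).1.mul_const _) fun α => hgsub n hn _)
    refine tendsto_nhds_unique h1 (tendsto_iff_dist_tendsto_zero.2 (squeeze_zero'
      (Eventually.of_forall fun n => dist_nonneg) h2 ?_))
    have := (tendsto_const_div_atTop_nhds_zero_nat (2 : ℝ)).const_mul (L (a ^ 2))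
    rwa [mul_zero] at this
  exact ⟨ν, hR, (isClosed_nonnegSet Q).measurableSet,
    measure_compl_nonnegSet hR.innerRegular hsupp, hint, heq⟩

end Representation

end CharMoment

theorem mainTheorem2 {A : Type*} [CommRing A] [Algebra ℝ A] (L : A →ₗ[ℝ] ℝ) (hL : L 1 = 1)
    (K : Set (CharMoment.CharSpace A)) (hK : IsClosed K) :
    (∃ Q : Set A, CharMoment.IsQuadraticModule Q ∧ K = CharMoment.nonnegSet Q) ∧
    ∀ Q : Set A, CharMoment.IsQuadraticModule Q → K = CharMoment.nonnegSet Q →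
      -- (i), the equivalence
      ((∃ μ : @Measure (CharMoment.CharSpace A) (CharMoment.cylinderSigma A),
          CharMoment.IsRepresenting univ L μ ∧
          ∀ S : CharMoment.fgSub A,
            μ (CharMoment.proj S.1 ⁻¹' CharMoment.nonnegSetRestr Q S.1)ᶜ = 0) ↔
        ∃ μ : ∀ S : CharMoment.fgSub A, Measure (CharMoment.CharSpace S.1),
          (∀ S, CharMoment.IsRadon (μ S) ∧
            CharMoment.IsRepresenting (CharMoment.nonnegSetRestr Q S.1)
              (CharMoment.restrictFunctional L S.1) (μ S)) ∧
          CharMoment.IsExact μ ∧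
          ∃ ν : ∀ T : CharMoment.cgSub A, Measure (CharMoment.CharSpace T.1),
            CharMoment.IsCorresponding μ ν ∧ CharMoment.IsExact ν ∧ CharMoment.IsThick ν) ∧
      -- (i), the additional claim for countably generated `Q`
      (CharMoment.IsCountablyGenerated Q →
        ∀ μ : @Measure (CharMoment.CharSpace A) (CharMoment.cylinderSigma A),
          CharMoment.IsRepresenting univ L μ →
          (∀ S : CharMoment.fgSub A,
            μ (CharMoment.proj S.1 ⁻¹' CharMoment.nonnegSetRestr Q S.1)ᶜ = 0) →
          CharMoment.IsRepresenting K L μ) ∧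
      -- (ii)
      ((∃ ν : Measure (CharMoment.CharSpace A),
          CharMoment.IsRadon ν ∧ CharMoment.IsRepresenting K L ν) ↔
        ∃ μ : ∀ S : CharMoment.fgSub A, Measure (CharMoment.CharSpace S.1),
          (∀ S, CharMoment.IsRadon (μ S) ∧
            CharMoment.IsRepresenting (CharMoment.nonnegSetRestr Q S.1)
              (CharMoment.restrictFunctional L S.1) (μ S)) ∧
          CharMoment.Prokhorov μ) := by
  refine ⟨CharMoment.exists_isQuadraticModule_eq_nonnegSet hK, ?_⟩
  rintro Q - rfl
  refine ⟨CharMoment.exists_cylinder_representing_iff L hL Q, fun hQ μ hμ hsupp =>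
    hμ.nonnegSet_of_isCountablyGenerated hQ hsupp, ?_, ?_⟩
  · rintro ⟨ν, hR, hν⟩
    exact CharMoment.exists_prokhorov_of_isRepresenting hL hR hν
  · rintro ⟨μ, hμ, hP⟩
    exact CharMoment.exists_isRepresenting_of_prokhorov hL (fun S => (hμ S).2) hP
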